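/- Let $K$ be an algebraically closed field of characteristic $0$, and let $H=(u(x,y),\,v(x,y,z),\,h(x,y))$ be a polynomial map with $u,h\in K[x,y]$ and $v\in K[x,y,z]$. Assume that $H(0)=0$, that $u,v,h$ are linearly independent over $K$, and that the Jacobian matrix $JH$ is nilpotent. Write $u_y=\partial u/\partial y$ and $h_y=\partial h/\partial y$, and for $f\in K[x,y]$ let $V(f)=\{p\in K^2 : f(p)=0\}$. If $V(u_y)$ or $V(h_y)$ is irreducible (that is, non-empty and not a union of two proper Zariski closed subsets), then there are $v_1,c_0,a\in K^*$, $l_1,l_2,\tilde l_2\in K$ and a polynomial $g\in K[t]$ with $g(0)=0$ and $\deg g\ge 1$ such that, with $b(x)=v_1c_0a\,x^2+l_1x+\tilde l_2$, $$u=g(ay+b(x)),\qquad v=v_1z-a^{-1}b'(x)\,g(ay+b(x))-v_1l_2x,\qquad h=c_0u^2+l_2u .$$ -/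

import Mathlib

open MvPolynomial

/-- The Jacobian matrix `(∂Hᵢ/∂xⱼ)` of a polynomial map `H : Kⁿ → Kⁿ`. -/
noncomputable def jacobianMatrix {K : Type*} [Field K] {n : ℕ}
    (H : Fin n → MvPolynomial (Fin n) K) : Matrix (Fin n) (Fin n) (MvPolynomial (Fin n) K) :=
  Matrix.of fun i j => pderiv j (H i)

/-- The inclusion `K[x, y] → K[x, y, z]`; the variables are `x = X 0`, `y = X 1`, `z = X 2`. -/
noncomputable def inclXY {K : Type*} [Field K] :
    MvPolynomial (Fin 2) K →ₐ[K] MvPolynomial (Fin 3) K :=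
  rename Fin.castSucc

/-- The polynomial map `H = (u(x, y), v(x, y, z), h(x, y))` of `K³`. -/
noncomputable def polyMap {K : Type*} [Field K]
    (u : MvPolynomial (Fin 2) K) (v : MvPolynomial (Fin 3) K) (h : MvPolynomial (Fin 2) K) :
    Fin 3 → MvPolynomial (Fin 3) K :=
  ![inclXY u, v, inclXY h]

/-- The variety `V(f) = {p ∈ Kⁿ | f(p) = 0}` of one polynomial. -/
def hypersurface {K : Type*} [Field K] {n : ℕ} (f : MvPolynomial (Fin n) K) : Set (Fin n → K) :=
  {p | eval p f = 0}

/-- Irreducibility in the Zariski topology of `Kⁿ`: the set is non-empty, and whenever it is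
covered by two algebraic sets (the Zariski closed sets), one of them contains it. -/
def IsIrreducibleVariety {K : Type*} [Field K] {n : ℕ} (Z : Set (Fin n → K)) : Prop :=
  Z.Nonempty ∧ ∀ I J : Ideal (MvPolynomial (Fin n) K),
    Z ⊆ zeroLocus K I ∪ zeroLocus K J → Z ⊆ zeroLocus K I ∨ Z ⊆ zeroLocus K J

/-- The form `u = g(ay + b(x))`, `v = v₁z - a⁻¹b'(x)g(ay + b(x)) - v₁l₂x`, `h = c₀u² + l₂u` with
`b(x) = v₁c₀ax² + l₁x + m₂`, where `v₁, c₀, a ∈ K*`, `l₁, l₂, m₂ ∈ K`, `g ∈ K[t]`, `g(0) = 0` and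
`deg g ≥ 1`. -/
def HasNormalForm {K : Type*} [Field K]
    (u : MvPolynomial (Fin 2) K) (v : MvPolynomial (Fin 3) K) (h : MvPolynomial (Fin 2) K) :
    Prop :=
  ∃ (v₁ c₀ a l₁ l₂ m₂ : K) (g b : Polynomial K),
    v₁ ≠ 0 ∧ c₀ ≠ 0 ∧ a ≠ 0 ∧ g.eval 0 = 0 ∧ 1 ≤ g.natDegree ∧
    b = Polynomial.C (v₁ * c₀ * a) * Polynomial.X ^ 2 + Polynomial.C l₁ * Polynomial.X +
      Polynomial.C m₂ ∧
    u = Polynomial.aeval (C a * X 1 + Polynomial.aeval (X 0) b) g ∧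
    v = C v₁ * X 2
      - C a⁻¹ * Polynomial.aeval (X 0) (Polynomial.derivative b) *
          Polynomial.aeval (C a * X 1 + Polynomial.aeval (X 0) b) g
      - C (v₁ * l₂) * X 0 ∧
    h = C c₀ * u ^ 2 + C l₂ * u

/-! Nilpotency makes the trace, the sum of the principal 2-minors and the determinant of `JH`
vanish. Differentiating these equations in `z` and using that `h` is not a multiple of `u` shows
that `v_z` is a constant `v₁`, so `v = v₁z + A(x, y)`. What remains is a system in the plane: `A_y =
-u_x`, `u_x A_y - u_y A_x = v₁h_y` and, if `v₁ ≠ 0`, `u_x h_y = u_y h_x`.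

The core is that the slope `s = u_x/u_y` is an affine polynomial in `x` alone
(`levelCurve_slope_affine`). On `K(x, y)` put `D = ∂_x - s∂_y` and `E = u_y⁻¹∂_y`. These are the
partial derivatives in the coordinates `(x, u)`, so they commute, and `D` kills `u` and `h`. The
system reads `DA = -v₁Eh` and `EA = -s`, whence `D²A = 0`, `D²s = 0` and, as `Dy = -s`, `D³y = 0`.
Thus `D` is nilpotent on every polynomial, in particular on `u_y`, and also on `u_y⁻¹ = Ey`. A unit
of the nilpotent part is a constant of `D`, so `D(u_y) = 0`. This says `s_y = 0`, and then `D²s = 0`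
becomes `s_xx = 0`.

With `s = cx + m`, integration gives `A` and `v₁h` in terms of `u` (`planeSystem_solution`), and a
shear turns `u_x = s u_y` into `u = g(y + b(x))` with `b' = s`
(`exists_eq_aeval_of_pderiv_zero_eq`). Linear independence forces `v₁ ≠ 0` and `c ≠ 0`. -/

namespace Derivation

/-! ### Elements on which a derivation is nilpotent. -/

section Nilpotency

variable {K A : Type*} [CommRing K] [CommRing A] [Algebra K A]

theorem iterate_add_apply (D : Derivation K A A) (n : ℕ) (a b : A) :
    D^[n] (a + b) = D^[n] a + D^[n] b := by
  induction n with
  | zero => rfl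
  | succ n ih => simp only [Function.iterate_succ_apply', ih, map_add]

theorem iterate_apply_zero (D : Derivation K A A) (n : ℕ) : D^[n] 0 = 0 := by
  induction n with
  | zero => rfl
  | succ n ih => simp only [Function.iterate_succ_apply', ih, map_zero]

theorem iterate_apply_eq_zero_of_le (D : Derivation K A A) {m n : ℕ} (hmn : m ≤ n) {a : A}
    (h : D^[m] a = 0) : D^[n] a = 0 := by
  obtain ⟨k, rfl⟩ := Nat.exists_eq_add_of_le hmn
  rw [add_comm, Function.iterate_add_apply, h, iterate_apply_zero]

open Finset in
/-- The general Leibniz rule. -/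
theorem iterate_apply_mul (D : Derivation K A A) (n : ℕ) (a b : A) :
    D^[n] (a * b) = ∑ ij ∈ antidiagonal n, n.choose ij.1 • (D^[ij.1] a * D^[ij.2] b) := by
  induction n with
  | zero => simp
  | succ n ih =>
    rw [sum_antidiagonal_choose_succ_nsmul (M := A) (fun i j => D^[i] a * D^[j] b) n]
    simp only [Function.iterate_succ_apply', ih, map_sum, map_nsmul, leibniz, smul_add,
      sum_add_distrib, add_right_inj, smul_eq_mul]
    refine sum_congr rfl fun ⟨i, j⟩ hij ↦ ?_
    rw [n.choose_symm_of_eq_add (HasAntidiagonal.mem_antidiagonal.1 hij).symm, mul_comm]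

/-- The subalgebra of elements annihilated by a power of a derivation. -/
def nilSubalgebra (D : Derivation K A A) : Subalgebra K A where
  carrier := {a | ∃ n, D^[n] a = 0}
  mul_mem' := by
    rintro a b ⟨m, hm⟩ ⟨n, hn⟩
    refine ⟨m + n, ?_⟩
    rw [iterate_apply_mul]
    refine Finset.sum_eq_zero fun ij hij ↦ ?_
    rw [Finset.HasAntidiagonal.mem_antidiagonal] at hij
    rcases le_or_gt m ij.1 with h | h
    · rw [D.iterate_apply_eq_zero_of_le h hm, zero_mul, smul_zero]
    · rw [D.iterate_apply_eq_zero_of_le (by omega : n ≤ ij.2) hn, mul_zero, smul_zero]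
  add_mem' := by
    rintro a b ⟨m, hm⟩ ⟨n, hn⟩
    refine ⟨m + n, ?_⟩
    rw [iterate_add_apply, D.iterate_apply_eq_zero_of_le (Nat.le_add_right m n) hm,
      D.iterate_apply_eq_zero_of_le (Nat.le_add_left n m) hn, add_zero]
  algebraMap_mem' := fun r ↦ ⟨1, by simp⟩

theorem mem_nilSubalgebra {D : Derivation K A A} {a : A} :
    a ∈ D.nilSubalgebra ↔ ∃ n, D^[n] a = 0 :=
  Iff.rfl

/-- A unit of the nilpotent part of a derivation on a domain of characteristic zero is a
constant. -/
theorem apply_eq_zero_of_mul_eq_one [IsDomain A] [CharZero A] {D : Derivation K A A} {a b : A}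
    (hab : a * b = 1) (ha : a ∈ D.nilSubalgebra) (hb : b ∈ D.nilSubalgebra) : D a = 0 := by
  classical
  rw [mem_nilSubalgebra] at ha hb
  have key : ∀ {c : A}, c ≠ 0 → (h : ∃ n, D^[n] c = 0) →
      ∃ m, D^[m] c ≠ 0 ∧ D^[m + 1] c = 0 := by
    intro c hc h
    obtain ⟨m, hm⟩ : ∃ m, Nat.find h = m + 1 :=
      Nat.exists_eq_succ_of_ne_zero fun h0 ↦ hc (by simpa [h0] using Nat.find_spec h)
    exact ⟨m, Nat.find_min h (by omega), hm ▸ Nat.find_spec h⟩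
  obtain ⟨m, hm, hm'⟩ := key (left_ne_zero_of_mul_eq_one hab) ha
  obtain ⟨n, hn, hn'⟩ := key (right_ne_zero_of_mul_eq_one hab) hb
  -- `m` and `n` are the last exponents with non-zero iterates, so one Leibniz term survives. It is
  -- non-zero, whereas `D` kills `a * b = 1`; hence `m = 0`.
  have h1 : D^[m + n] (a * b) = (m + n).choose m • (D^[m] a * D^[n] b) := by
    rw [iterate_apply_mul]
    refine Finset.sum_eq_single_of_mem (m, n) (by simp) fun ij hij hne ↦ ?_
    rw [Finset.HasAntidiagonal.mem_antidiagonal] at hij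
    rcases lt_trichotomy m ij.1 with h | h | h
    · rw [D.iterate_apply_eq_zero_of_le (Nat.succ_le_of_lt h) hm', zero_mul, smul_zero]
    · exact absurd (Prod.ext h.symm (by dsimp only; omega)) hne
    · rw [D.iterate_apply_eq_zero_of_le (by omega : n + 1 ≤ ij.2) hn', mul_zero, smul_zero]
  have h2 : D^[m + n] (a * b) ≠ 0 := by
    rw [h1, nsmul_eq_mul]
    exact mul_ne_zero (Nat.cast_ne_zero.2 (Nat.choose_pos (Nat.le_add_right m n)).ne')
      (mul_ne_zero hm hn)
  rcases m with _ | m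
  · exact hm'
  · refine absurd ?_ h2
    rw [hab]
    exact D.iterate_apply_eq_zero_of_le (by omega : 1 ≤ m + 1 + n) (by simp)

end Nilpotency

/-! ### Extension of derivations to the field of fractions, through dual numbers. -/

section FractionField

theorem eq_zero_of_algebraMap {K A F : Type*} [CommRing K] [CommRing A] [Field F] [Algebra A F]
    [Algebra K F] [IsFractionRing A F] (D : Derivation K F F)
    (h : ∀ a : A, D (algebraMap A F a) = 0) : D = 0 := by
  ext f
  obtain ⟨a, b, -, rfl⟩ := IsFractionRing.div_surjective (A := A) f
  simp [leibniz_div, h]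

variable {K A F : Type*} [Field K] [CommRing A] [Algebra K A] [Field F] [Algebra A F]
  [Algebra K F] [IsScalarTower K A F]

/-- The algebra homomorphism `a ↦ a + ε D a` to the dual numbers over the field of fractions. -/
noncomputable def toDualNumber (F : Type*) [Field F] [Algebra A F]
    [Algebra K F] [IsScalarTower K A F] (D : Derivation K A A) : A →ₐ[K] TrivSqZeroExt F F :=
  AlgHom.ofLinearMap
    (LinearMap.prod (IsScalarTower.toAlgHom K A F).toLinearMap
      ((IsScalarTower.toAlgHom K A F).toLinearMap ∘ₗ D.toLinearMap))
    (TrivSqZeroExt.ext (map_one (algebraMap A F))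
      ((congrArg (algebraMap A F) D.map_one_eq_zero).trans (map_zero _)))
    (fun a b ↦ TrivSqZeroExt.ext (map_mul (algebraMap A F) a b) <| by
      change algebraMap A F (D (a * b)) = algebraMap A F a * algebraMap A F (D b) +
        algebraMap A F (D a) * algebraMap A F b
      simp [mul_comm])

theorem fst_toDualNumber (D : Derivation K A A) (a : A) :
    (D.toDualNumber F a).fst = algebraMap A F a :=
  rfl

theorem snd_toDualNumber (D : Derivation K A A) (a : A) :
    (D.toDualNumber F a).snd = algebraMap A F (D a) :=
  rfl

variable [IsFractionRing A F]

/-- The extension to the field of fractions of the homomorphism `a ↦ a + ε D a`. -/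
noncomputable def fractionRingToDualNumber (F : Type*) [Field F] [Algebra A F]
    [Algebra K F] [IsScalarTower K A F] [IsFractionRing A F] (D : Derivation K A A) :
    F →ₐ[K] TrivSqZeroExt F F :=
  IsLocalization.liftAlgHom (M := nonZeroDivisors A) (f := D.toDualNumber F) fun y ↦ by
    rw [TrivSqZeroExt.isUnit_iff_isUnit_fst]
    exact IsLocalization.map_units F y

theorem fractionRingToDualNumber_algebraMap (D : Derivation K A A) (a : A) :
    D.fractionRingToDualNumber F (algebraMap A F a) = D.toDualNumber F a := by
  simp [fractionRingToDualNumber]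

theorem fst_fractionRingToDualNumber (D : Derivation K A A) (f : F) :
    (D.fractionRingToDualNumber F f).fst = f := by
  have : (TrivSqZeroExt.fstHom K F F).comp (D.fractionRingToDualNumber F) = AlgHom.id K F := by
    refine IsLocalization.algHom_ext (nonZeroDivisors A) (AlgHom.ext fun a ↦ ?_)
    change (D.fractionRingToDualNumber F (algebraMap A F a)).fst = algebraMap A F a
    simp [fractionRingToDualNumber_algebraMap, fst_toDualNumber]
  exact DFunLike.congr_fun this f

/-- The extension of a derivation to the field of fractions. -/
noncomputable def liftFractionRing (F : Type*) [Field F] [Algebra A F]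
    [Algebra K F] [IsScalarTower K A F] [IsFractionRing A F] (D : Derivation K A A) :
    Derivation K F F :=
  Derivation.mk' ((TrivSqZeroExt.sndHom F F).restrictScalars K ∘ₗ
    (D.fractionRingToDualNumber F).toLinearMap) fun a b ↦ by
      simp [fst_fractionRingToDualNumber, mul_comm]

theorem liftFractionRing_algebraMap (D : Derivation K A A) (a : A) :
    D.liftFractionRing F (algebraMap A F a) = algebraMap A F (D a) := by
  simp [liftFractionRing, fractionRingToDualNumber_algebraMap, snd_toDualNumber]

/-- The commutator is itself a derivation, so it is enough that it vanishes on `A`. -/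
theorem liftFractionRing_comm {D E : Derivation K A A} (h : ∀ a, D (E a) = E (D a)) (f : F) :
    D.liftFractionRing F (E.liftFractionRing F f) =
      E.liftFractionRing F (D.liftFractionRing F f) := by
  have : ⁅D.liftFractionRing F, E.liftFractionRing F⁆ = 0 :=
    eq_zero_of_algebraMap (A := A) _ fun a ↦ by
      simp [commutator_apply, liftFractionRing_algebraMap, h]
  rw [← sub_eq_zero, ← commutator_apply, this, zero_apply]

end FractionField

end Derivation

/-! ### Partial derivatives and their constants, for polynomials and rational functions. -/

namespace MvPolynomial

theorem algebraMap_mem_nilSubalgebra {K σ B : Type*} [CommRing K] [CommRing B] [Algebra K B]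
    [Algebra (MvPolynomial σ K) B] [IsScalarTower K (MvPolynomial σ K) B] {D : Derivation K B B}
    (h : ∀ i, algebraMap (MvPolynomial σ K) B (X i) ∈ D.nilSubalgebra) (p : MvPolynomial σ K) :
    algebraMap (MvPolynomial σ K) B p ∈ D.nilSubalgebra := by
  induction p using MvPolynomial.induction_on with
  | C a =>
    have := D.nilSubalgebra.algebraMap_mem a
    rwa [IsScalarTower.algebraMap_apply K (MvPolynomial σ K) B] at this
  | add p q hp hq => rw [map_add]; exact add_mem hp hq
  | mul_X p i hp => rw [map_mul]; exact mul_mem hp (h i)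

theorem exists_iterate_pderiv_eq_zero {K σ : Type*} [CommRing K] (i : σ) (p : MvPolynomial σ K) :
    ∃ n, (pderiv i)^[n] p = 0 := by
  classical
  refine algebraMap_mem_nilSubalgebra (D := pderiv i) (fun j ↦ ⟨2, ?_⟩) p
  simp only [Function.iterate_succ, Function.iterate_zero, Function.comp_apply, id,
    Algebra.algebraMap_self, RingHom.id_apply, pderiv_X]
  by_cases h : i = j
  · subst h; simp
  · simp [h]

theorem pderiv_comm {K σ : Type*} [CommRing K] (i j : σ) (p : MvPolynomial σ K) :
    pderiv i (pderiv j p) = pderiv j (pderiv i p) := by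
  classical
  have : ⁅(pderiv i : Derivation K (MvPolynomial σ K) (MvPolynomial σ K)),
      (pderiv j : Derivation K (MvPolynomial σ K) (MvPolynomial σ K))⁆ = 0 := by
    refine MvPolynomial.derivation_ext fun k ↦ ?_
    simp only [Derivation.commutator_apply, pderiv_X, Pi.single_apply]
    split_ifs <;> simp
  rw [← sub_eq_zero, ← Derivation.commutator_apply, this, Derivation.zero_apply]

variable {K σ : Type*} [Field K] [CharZero K]

theorem notMem_vars_of_pderiv_eq_zero {i : σ} {p : MvPolynomial σ K} (h : pderiv i p = 0) :
    i ∉ p.vars := by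
  rw [mem_vars_iff_mem_support]
  rintro ⟨m, hm, hi⟩
  have hle : Finsupp.single i 1 ≤ m := by
    rw [Finsupp.single_le_iff]
    exact Nat.one_le_iff_ne_zero.2 (Finsupp.mem_support_iff.1 hi)
  have h1 := coeff_pderiv (i := i) p (m - Finsupp.single i 1)
  rw [h, coeff_zero, tsub_add_cancel_of_le hle] at h1
  refine mul_ne_zero (mem_support_iff.1 hm) ?_ h1.symm
  exact Nat.cast_add_one_ne_zero _

theorem exists_eq_C_of_pderiv_eq_zero {p : MvPolynomial σ K} (h : ∀ i, pderiv i p = 0) :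
    ∃ c, p = C c := by
  have : p ∈ supported K (∅ : Set σ) := by
    rw [mem_supported]
    exact fun i hi ↦ notMem_vars_of_pderiv_eq_zero (h i) hi
  rw [supported_empty, Algebra.mem_bot] at this
  obtain ⟨c, hc⟩ := this
  exact ⟨c, hc.symm⟩

theorem degreeOf_pderiv_lt {K σ : Type*} [Field K] {i : σ} {p : MvPolynomial σ K} (h : pderiv i p ≠ 0) :
    degreeOf i (pderiv i p) < degreeOf i p := by
  have hpos : 0 < degreeOf i p := by
    by_contra h0
    refine h (pderiv_eq_zero_of_notMem_vars fun hi ↦ h0 ?_)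
    rw [mem_vars_iff_mem_support] at hi
    obtain ⟨m, hm, hi⟩ := hi
    exact (Nat.pos_of_ne_zero (Finsupp.mem_support_iff.1 hi)).trans_le (monomial_le_degreeOf i hm)
  rw [degreeOf_lt_iff hpos]
  intro m hm
  have h1 : m + Finsupp.single i 1 ∈ p.support := by
    rw [mem_support_iff] at hm ⊢
    rw [coeff_pderiv] at hm
    exact left_ne_zero_of_mul hm
  have h2 := monomial_le_degreeOf i h1
  rw [Finsupp.add_apply, Finsupp.single_eq_same] at h2
  omega

/-- A non-zero derivative has smaller degree in `X i` than `p`, hence is no multiple of `p`. -/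
theorem pderiv_eq_zero_of_dvd {K σ : Type*} [Field K] {i : σ} {p : MvPolynomial σ K} (h : p ∣ pderiv i p) :
    pderiv i p = 0 := by
  by_contra h0
  obtain ⟨q, hq⟩ := h
  have hp : p ≠ 0 := fun hp ↦ h0 (by rw [hp, map_zero])
  have hq0 : q ≠ 0 := fun hq0 ↦ h0 (by rw [hq, hq0, mul_zero])
  have h1 := degreeOf_pderiv_lt h0
  have h2 := degreeOf_mul_eq (n := i) hp hq0
  rw [← hq] at h2
  omega

/-- A rational function all of whose partial derivatives vanish is a constant. -/
theorem exists_eq_algebraMap_of_liftFractionRing_pderiv_eq_zero {F : Type*} [Field F]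
    [Algebra (MvPolynomial σ K) F] [Algebra K F] [IsScalarTower K (MvPolynomial σ K) F]
    [IsFractionRing (MvPolynomial σ K) F] {f : F}
    (h : ∀ i : σ, (pderiv i : Derivation K (MvPolynomial σ K) _).liftFractionRing F f = 0) :
    ∃ c : K, f = algebraMap K F c := by
  set p := IsFractionRing.num (MvPolynomial σ K) f with hp
  set q : MvPolynomial σ K := (IsFractionRing.den (MvPolynomial σ K) f : MvPolynomial σ K) with hq
  have hpq : IsRelPrime p q := IsFractionRing.num_den_reduced (MvPolynomial σ K) f
  have hq0 : q ≠ 0 := nonZeroDivisors.ne_zero (IsFractionRing.den (MvPolynomial σ K) f).2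
  have hinj := IsFractionRing.injective (MvPolynomial σ K) F
  have hf : f * algebraMap _ F q = algebraMap _ F p := by
    rw [eq_comm, ← div_eq_iff ((map_ne_zero_iff _ hinj).2 hq0)]
    exact IsFractionRing.mk'_num_den' (MvPolynomial σ K) f
  have key : ∀ i, p * pderiv i q = q * pderiv i p := by
    intro i
    apply hinj
    have h1 := congrArg ((pderiv i : Derivation K (MvPolynomial σ K) _).liftFractionRing F) hf
    rw [Derivation.leibniz, h, Derivation.liftFractionRing_algebraMap,
      Derivation.liftFractionRing_algebraMap, smul_zero, add_zero, smul_eq_mul] at h1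
    rw [map_mul, map_mul, ← h1, ← hf]
    ring
  -- Since `p` and `q` are coprime, `key` makes the denominator divide its own derivative.
  have hqi : ∀ i, pderiv i q = 0 := fun i ↦
    pderiv_eq_zero_of_dvd (hpq.symm.dvd_of_dvd_mul_left ⟨_, key i⟩)
  have hpi : ∀ i, pderiv i p = 0 := fun i ↦ by
    have := key i
    rw [hqi, mul_zero] at this
    exact (mul_eq_zero.1 this.symm).resolve_left hq0
  obtain ⟨a, ha⟩ := exists_eq_C_of_pderiv_eq_zero hpi
  obtain ⟨b, hb⟩ := exists_eq_C_of_pderiv_eq_zero hqi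
  have hb0 : b ≠ 0 := fun h0 ↦ hq0 (by rw [hb, h0, C_0])
  refine ⟨a / b, ?_⟩
  rw [ha, hb, ← algebraMap_eq, ← IsScalarTower.algebraMap_apply,
    ← IsScalarTower.algebraMap_apply] at hf
  rw [map_div₀, eq_div_iff (by simpa using hb0), hf]

end MvPolynomial

/-! ### The slope of the level curves of `u`. -/

section PlaneSystem

variable {K : Type*} [Field K]

/-- The bracket of `∂₀ - (∂₀u / ∂₁u) ∂₁` and `(∂₁u)⁻¹ ∂₁` vanishes for commuting `∂₀`, `∂₁`. -/
theorem levelCurve_derivations_comm {F : Type*} [Field F] [Algebra K F] {d₀ d₁ : Derivation K F F}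
    (hcomm : ∀ f, d₀ (d₁ f) = d₁ (d₀ f)) {u : F} (hu : d₁ u ≠ 0) (f : F) :
    (d₀ - (d₀ u / d₁ u) • d₁) ((d₁ u)⁻¹ • d₁ f) =
      (d₁ u)⁻¹ • d₁ ((d₀ - (d₀ u / d₁ u) • d₁) f) := by
  simp only [Derivation.sub_apply, Derivation.smul_apply, smul_eq_mul, Derivation.leibniz,
    Derivation.leibniz_inv, Derivation.leibniz_div, map_sub, hcomm]
  field_simp
  ring

/-- The slope of the level curves of `u` is affine in the first variable. -/
theorem levelCurve_slope_affine {F : Type*} [Field F] [CharZero F] [Algebra K F]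
    {d₀ d₁ : Derivation K F F} (hcomm : ∀ f, d₀ (d₁ f) = d₁ (d₀ f)) {x y u A h : F} {κ : K}
    (hx₀ : d₀ x = 1) (hx₁ : d₁ x = 0) (hy₀ : d₀ y = 0) (hy₁ : d₁ y = 1)
    (hu : d₁ u ≠ 0) (hu_mem : d₁ u ∈ Algebra.adjoin K {x, y}) (hA : d₁ A = -d₀ u)
    (huh : d₀ u * d₁ h = d₁ u * d₀ h)
    (hκ : d₀ u * d₁ A - d₁ u * d₀ A = algebraMap K F κ * d₁ h) :
    d₁ (d₀ u / d₁ u) = 0 ∧ d₀ (d₀ (d₀ u / d₁ u)) = 0 := by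
  set s := d₀ u / d₁ u with hs
  set D := d₀ - s • d₁ with hD
  have hDapply : ∀ f, D f = d₀ f - s * d₁ f := fun f ↦ rfl
  have hDE : ∀ f, D ((d₁ u)⁻¹ * d₁ f) = (d₁ u)⁻¹ * d₁ (D f) :=
    levelCurve_derivations_comm hcomm hu
  have hx : D x = 1 := by rw [hDapply, hx₀, hx₁, mul_zero, sub_zero]
  have hy : D y = -s := by rw [hDapply, hy₀, hy₁, mul_one, zero_sub]
  have hDh : D h = 0 := by
    rw [hDapply, hs]
    field_simp
    linear_combination -huh
  have hDA : D A = -algebraMap K F κ * ((d₁ u)⁻¹ * d₁ h) := by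
    rw [hDapply, hs]
    field_simp
    linear_combination -hκ
  have hEA : (d₁ u)⁻¹ * d₁ A = -s := by
    rw [hA, hs]
    field_simp
  have hDDA : D (D A) = 0 := by
    rw [hDA, Derivation.leibniz, hDE, hDh, map_neg, Derivation.map_algebraMap]
    simp
  have hDDs : D (D s) = 0 := by
    rw [← neg_eq_zero, ← map_neg, ← map_neg, ← hEA, hDE, hDE, hDDA, map_zero, mul_zero]
  have hDDDy : D (D (D y)) = 0 := by
    rw [hy, map_neg, map_neg, hDDs, neg_zero]
  -- Both `d₁ u` and its inverse lie in the nilpotent part of `D`: the former is a polynomial in `x`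
  -- and `y`, the latter is `(d₁ u)⁻¹ * d₁ y`, and `D` commutes with `(d₁ u)⁻¹ • d₁`.
  have hDu : D (d₁ u) = 0 := by
    refine Derivation.apply_eq_zero_of_mul_eq_one (mul_inv_cancel₀ hu) ?_ ⟨3, ?_⟩
    · refine Algebra.adjoin_le ?_ hu_mem
      rintro f (rfl | rfl)
      · exact ⟨2, by change D (D f) = 0; rw [hx, Derivation.map_one_eq_zero]⟩
      · exact ⟨3, hDDDy⟩
    · have hE : (d₁ u)⁻¹ = (d₁ u)⁻¹ * d₁ y := by rw [hy₁, mul_one]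
      rw [hE]
      change D (D (D _)) = 0
      rw [hDE, hDE, hDE, hDDDy, map_zero, mul_zero]
  -- By the quotient rule `D (d₁ u) = d₁ u * d₁ s`.
  have hs₁ : d₁ s = 0 := by
    rw [hDapply, hcomm, hs] at hDu
    rw [hs, Derivation.leibniz_div, smul_eq_mul, smul_eq_mul, smul_eq_mul]
    field_simp at hDu ⊢
    linear_combination hDu
  refine ⟨hs₁, ?_⟩
  rwa [hDapply, hDapply, hs₁, mul_zero, sub_zero, ← hcomm, hs₁, map_zero, mul_zero,
    sub_zero] at hDDs

variable [CharZero K]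

/-- The level curves of `u` are parabolas with a common direction of axis. -/
theorem exists_pderiv_zero_eq_affine_mul_pderiv_one {u A h : MvPolynomial (Fin 2) K} {κ : K}
    (hu : pderiv 1 u ≠ 0) (hA : pderiv 1 A = -pderiv 0 u)
    (huh : pderiv 0 u * pderiv 1 h = pderiv 1 u * pderiv 0 h)
    (hκ : pderiv 0 u * pderiv 1 A - pderiv 1 u * pderiv 0 A = C κ * pderiv 1 h) :
    ∃ c m : K, pderiv 0 u = (C c * X 0 + C m) * pderiv 1 u := by
  let F := FractionRing (MvPolynomial (Fin 2) K)
  let ι := algebraMap (MvPolynomial (Fin 2) K) F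
  have hinj : Function.Injective ι := IsFractionRing.injective _ F
  have hιC : ∀ a : K, ι (C a) = algebraMap K F a := fun a ↦
    (IsScalarTower.algebraMap_apply K (MvPolynomial (Fin 2) K) F a).symm
  let d : Fin 2 → Derivation K F F := fun i ↦ (pderiv i).liftFractionRing F
  have hd : ∀ i p, d i (ι p) = ι (pderiv i p) := fun i ↦ Derivation.liftFractionRing_algebraMap _
  have hcomm : ∀ f, d 0 (d 1 f) = d 1 (d 0 f) := Derivation.liftFractionRing_comm (pderiv_comm 0 1)
  have hU : d 1 (ι u) ≠ 0 := by rw [hd]; exact (map_ne_zero_iff _ hinj).2 hu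
  have : CharZero F := charZero_of_injective_algebraMap (algebraMap K F).injective
  have hmem : d 1 (ι u) ∈ Algebra.adjoin K {ι (X 0), ι (X 1)} := by
    rw [hd]
    induction pderiv 1 u using MvPolynomial.induction_on with
    | C a => rw [hιC]; exact Subalgebra.algebraMap_mem _ a
    | add p q hp hq => rw [map_add]; exact add_mem hp hq
    | mul_X p i hp =>
      rw [map_mul]
      refine mul_mem hp (Algebra.subset_adjoin ?_)
      fin_cases i
      · exact Or.inl rfl
      · exact Or.inr rfl
  obtain ⟨hs₁, hs₀⟩ := levelCurve_slope_affine (κ := κ) hcomm (x := ι (X 0)) (y := ι (X 1))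
    (u := ι u) (A := ι A) (h := ι h) (by simp [hd]) (by simp [hd]) (by simp [hd]) (by simp [hd])
    hU hmem (by rw [hd, hd, hA, map_neg]) (by simp only [hd, ← map_mul, huh])
    (by simp only [hd, ← hιC, ← map_mul, ← map_sub, hκ])
  have const : ∀ f : F, d 0 f = 0 → d 1 f = 0 → ∃ c : K, f = algebraMap K F c :=
    fun f h0 h1 ↦ exists_eq_algebraMap_of_liftFractionRing_pderiv_eq_zero (σ := Fin 2) fun i ↦ by
      fin_cases i
      · exact h0
      · exact h1
  obtain ⟨c, hc⟩ := const _ hs₀ (by rw [← hcomm, hs₁, map_zero])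
  obtain ⟨m, hm⟩ := const (d 0 (ι u) / d 1 (ι u) - ι (C c) * ι (X 0))
    (by rw [map_sub, Derivation.leibniz, hc, hd, hd, hιC]; simp)
    (by rw [map_sub, Derivation.leibniz, hs₁, hd, hd]; simp)
  refine ⟨c, m, hinj ?_⟩
  rw [map_mul, map_add, map_mul, hιC m, ← hm, add_sub_cancel, ← hd, ← hd, div_mul_cancel₀ _ hU]

end PlaneSystem

/-! ### Integration of the plane system. -/

section PlaneSystem

variable {K : Type*} [Field K] [CharZero K]

theorem MvPolynomial.eq_zero_of_pderiv_eq_zero {σ : Type*} {p : MvPolynomial σ K}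
    (h : ∀ i, pderiv i p = 0) (h0 : eval 0 p = 0) : p = 0 := by
  obtain ⟨c, rfl⟩ := exists_eq_C_of_pderiv_eq_zero h
  rw [eval_C] at h0
  rw [h0, C_0]

/-- With `s = cx + m`, the sum `W = A + su` is free of `y` and `u_y W_x = c u u_y - κh_y`. The
derivation `∂_x - s∂_y` kills `u`, `u_y` and `h_y`, so `W_xx = 0` and `W = dx`; then `κh_y = (cu -
d)u_y` integrates. The value `κ = 0` is allowed, which serves to exclude `v₁ = 0`. -/
theorem planeSystem_solution {u A h : MvPolynomial (Fin 2) K} {κ : K}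
    (hu : pderiv 1 u ≠ 0) (hA : pderiv 1 A = -pderiv 0 u)
    (huh : pderiv 0 u * pderiv 1 h = pderiv 1 u * pderiv 0 h)
    (hκ : pderiv 0 u * pderiv 1 A - pderiv 1 u * pderiv 0 A = C κ * pderiv 1 h)
    (u_zero : eval 0 u = 0) (A_zero : eval 0 A = 0) (h_zero : eval 0 h = 0) :
    ∃ c m d : K, pderiv 0 u = (C c * X 0 + C m) * pderiv 1 u ∧
      A = C d * X 0 - (C c * X 0 + C m) * u ∧ C κ * h = C (c / 2) * u ^ 2 - C d * u := by
  obtain ⟨c, m, hs⟩ := exists_pderiv_zero_eq_affine_mul_pderiv_one hu hA huh hκ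
  set s : MvPolynomial (Fin 2) K := C c * X 0 + C m with hs_def
  have hs0 : pderiv 0 s = C c := by simp [hs_def]
  have hs1 : pderiv 1 s = 0 := by simp [hs_def]
  have hh : pderiv 0 h = s * pderiv 1 h := by
    refine mul_left_cancel₀ hu ?_
    rw [← huh, hs]
    ring
  have hu01 : pderiv 0 (pderiv 1 u) = s * pderiv 1 (pderiv 1 u) := by
    rw [pderiv_comm, hs, Derivation.leibniz, hs1]
    simp
  have hh01 : pderiv 0 (pderiv 1 h) = s * pderiv 1 (pderiv 1 h) := by
    rw [pderiv_comm, hh, Derivation.leibniz, hs1]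
    simp
  obtain ⟨W, hW⟩ : ∃ W, W = A + s * u := ⟨_, rfl⟩
  have hW1 : pderiv 1 W = 0 := by
    rw [hW, map_add, Derivation.leibniz, hs1, hA, hs]
    simp
  have hW0 : pderiv 1 u * pderiv 0 W = C c * u * pderiv 1 u - C κ * pderiv 1 h := by
    rw [hW, map_add, Derivation.leibniz, hs0, smul_eq_mul, smul_eq_mul, ← hκ, hA, hs]
    ring
  have hW00 : pderiv 0 (pderiv 0 W) = 0 := by
    refine (mul_eq_zero.1 ?_).resolve_left hu
    have e0 := congrArg (pderiv 0) hW0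
    have e1 := congrArg (pderiv 1) hW0
    simp only [map_sub, Derivation.leibniz, pderiv_C, smul_eq_mul, hu01, hh01, mul_zero, add_zero,
      pderiv_comm 1 0 W, hW1, map_zero, zero_add] at e0 e1
    linear_combination e0 - s * e1 + C c * pderiv 1 u * hs
  obtain ⟨d, hd⟩ : ∃ d, pderiv 0 W = C d := by
    refine exists_eq_C_of_pderiv_eq_zero fun i ↦ ?_
    fin_cases i
    · exact hW00
    · change pderiv 1 (pderiv 0 W) = 0
      rw [pderiv_comm, hW1, map_zero]
  have hWd : W - C d * X 0 = 0 := by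
    refine eq_zero_of_pderiv_eq_zero (fun i ↦ ?_) (by
      simp only [hW, map_sub, map_add, map_mul, eval_C, eval_X, u_zero, A_zero, Pi.zero_apply,
        mul_zero, add_zero, sub_zero])
    fin_cases i
    · change pderiv 0 _ = _
      simp [hd]
    · change pderiv 1 _ = _
      simp [hW1]
  have h2 : (C (c / 2) : MvPolynomial (Fin 2) K) * 2 = C c := by
    rw [← map_ofNat C 2, ← C_mul, div_mul_cancel₀ c two_ne_zero]
  have hk1 : pderiv 1 (C κ * h - (C (c / 2) * u ^ 2 - C d * u)) = 0 := by
    rw [hd] at hW0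
    simp only [map_sub, Derivation.leibniz, Derivation.leibniz_pow, pderiv_C, smul_eq_mul,
      nsmul_eq_mul, mul_zero, add_zero]
    push_cast
    linear_combination hW0 - u * pderiv 1 u * h2
  have hk0 : pderiv 0 (C κ * h - (C (c / 2) * u ^ 2 - C d * u)) = 0 := by
    rw [← mul_zero s, ← hk1]
    simp only [map_sub, Derivation.leibniz, Derivation.leibniz_pow, pderiv_C, smul_eq_mul,
      nsmul_eq_mul, mul_zero, add_zero, hs, hh]
    ring
  have hk : C κ * h - (C (c / 2) * u ^ 2 - C d * u) = 0 := by
    refine eq_zero_of_pderiv_eq_zero (fun i ↦ ?_) (by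
      simp only [map_sub, map_mul, map_pow, eval_C, u_zero, h_zero, mul_zero, sub_zero, ne_eq,
        OfNat.ofNat_ne_zero, not_false_eq_true, zero_pow])
    fin_cases i
    · exact hk0
    · exact hk1
  refine ⟨c, m, d, hs, ?_, sub_eq_zero.1 hk⟩
  linear_combination hWd - hW

/-- A solution of `∂₀u = b'(x) ∂₁u` is a polynomial in `y + b(x)`. -/
theorem exists_eq_aeval_of_pderiv_zero_eq {u : MvPolynomial (Fin 2) K} {b : Polynomial K}
    (h : pderiv 0 u = Polynomial.aeval (X 0) (Polynomial.derivative b) * pderiv 1 u) :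
    ∃ g : Polynomial K, u = Polynomial.aeval (X 1 + Polynomial.aeval (X 0) b) g := by
  set β : MvPolynomial (Fin 2) K := Polynomial.aeval (X 0) b with hβ
  have hβ0 : pderiv 0 β = Polynomial.aeval (X 0) (Polynomial.derivative b) := by
    rw [hβ, Derivation.map_aeval]
    simp
  -- The shear `y ↦ y - b(x)` straightens the curves `y + b(x) = const`, so that `θ u` depends on
  -- `y` only; `θ'` undoes it.
  let θ : MvPolynomial (Fin 2) K →ₐ[K] MvPolynomial (Fin 2) K := aeval ![X 0, X 1 - β]
  let θ' : MvPolynomial (Fin 2) K →ₐ[K] MvPolynomial (Fin 2) K := aeval ![X 0, X 1 + β]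
  have hθ0 : θ (X 0) = X 0 := by simp [θ]
  have hθ1 : θ (X 1) = X 1 - β := by simp [θ]
  have hθ'0 : θ' (X 0) = X 0 := by simp [θ']
  have hθ'1 : θ' (X 1) = X 1 + β := by simp [θ']
  have hθβ (φ : MvPolynomial (Fin 2) K →ₐ[K] MvPolynomial (Fin 2) K) (hφ : φ (X 0) = X 0)
      (q : Polynomial K) : φ (Polynomial.aeval (X 0) q) = Polynomial.aeval (X 0) q := by
    rw [← Polynomial.aeval_algHom_apply, hφ]
  have hinv : θ'.comp θ = AlgHom.id K _ := by
    refine algHom_ext fun i ↦ ?_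
    fin_cases i
    · change θ' (θ (X 0)) = X 0
      rw [hθ0, hθ'0]
    · change θ' (θ (X 1)) = X 1
      rw [hθ1, map_sub, hθ'1, hβ, hθβ θ' hθ'0, add_sub_cancel_right]
  have chain : ∀ p, pderiv 0 (θ p) = θ (pderiv 0 p) - pderiv 0 β * θ (pderiv 1 p) := by
    intro p
    induction p using MvPolynomial.induction_on with
    | C a => simp [θ]
    | add p q hp hq => simp only [map_add, hp, hq]; ring
    | mul_X p i hp =>
      simp only [map_mul, Derivation.leibniz, map_add, smul_eq_mul, hp]
      fin_cases i
      · change θ p * pderiv 0 (θ (X 0)) + θ (X 0) * _ = θ p * θ (pderiv 0 (X 0)) +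
          θ (X 0) * _ - _ * (θ p * θ (pderiv 1 (X 0)) + θ (X 0) * _)
        rw [hθ0, pderiv_X_self, pderiv_X_of_ne (by decide), map_one, map_zero]
        ring
      · change θ p * pderiv 0 (θ (X 1)) + θ (X 1) * _ = θ p * θ (pderiv 0 (X 1)) +
          θ (X 1) * _ - _ * (θ p * θ (pderiv 1 (X 1)) + θ (X 1) * _)
        rw [hθ1, pderiv_X_self, map_sub, pderiv_X_of_ne (by decide), map_one, map_zero]
        ring
  have hθu : pderiv 0 (θ u) = 0 := by
    rw [chain, h, map_mul, hθβ θ hθ0, hβ0, sub_self]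
  have hmem : θ u ∈ supported K ({1} : Set (Fin 2)) := by
    rw [mem_supported]
    intro i hi
    fin_cases i
    · exact absurd hi (notMem_vars_of_pderiv_eq_zero hθu)
    · rfl
  rw [supported, Set.image_singleton, Algebra.adjoin_singleton_eq_range_aeval] at hmem
  obtain ⟨g, hg⟩ := hmem
  refine ⟨g, ?_⟩
  rw [← hθ'1, Polynomial.aeval_algHom_apply]
  change u = θ' ((Polynomial.aeval (X 1)).toRingHom g)
  rw [hg]
  exact (DFunLike.congr_fun hinv u).symm

end PlaneSystem

/-! ### Reduction to the plane: `v` is affine in `z`. -/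

section Reduction

/-- The trace of the square stands in for the sum of the principal 2-minors, which is half of `(tr
M)² - tr(M²)`. -/
theorem Matrix.trace_mul_self_and_det_eq_zero_of_isNilpotent {R n : Type*} [CommRing R] [IsReduced R]
    [Fintype n] [DecidableEq n] [Nonempty n] {M : Matrix n n R} (hM : IsNilpotent M) :
    M.trace = 0 ∧ (M * M).trace = 0 ∧ M.det = 0 := by
  refine ⟨(Matrix.isNilpotent_trace_of_isNilpotent hM).eq_zero,
    (Matrix.isNilpotent_trace_of_isNilpotent ?_).eq_zero, ?_⟩
  · exact (Commute.refl M).isNilpotent_mul_right hM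
  · obtain ⟨k, hk⟩ := hM
    refine IsNilpotent.eq_zero ⟨k + 1, ?_⟩
    rw [← Matrix.det_pow, pow_succ, hk, zero_mul, Matrix.det_zero]

variable {K : Type*} [Field K]

theorem inclXY_injective : Function.Injective (inclXY (K := K)) :=
  rename_injective _ (Fin.castSucc_injective 2)

theorem pderiv_zero_inclXY (p : MvPolynomial (Fin 2) K) :
    pderiv 0 (inclXY p) = inclXY (pderiv 0 p) :=
  pderiv_rename (Fin.castSucc_injective 2) 0 p

theorem pderiv_one_inclXY (p : MvPolynomial (Fin 2) K) :
    pderiv 1 (inclXY p) = inclXY (pderiv 1 p) :=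
  pderiv_rename (Fin.castSucc_injective 2) 1 p

theorem pderiv_two_inclXY (p : MvPolynomial (Fin 2) K) : pderiv 2 (inclXY p) = 0 := by
  classical
  refine pderiv_eq_zero_of_notMem_vars fun h ↦ ?_
  obtain ⟨i, -, hi⟩ := Finset.mem_image.1 (vars_rename Fin.castSucc p h)
  exact (Fin.castSucc_lt_last i).ne hi

theorem eval_zero_inclXY (p : MvPolynomial (Fin 2) K) : eval 0 (inclXY p) = eval 0 p := by
  rw [inclXY, eval_rename]
  rfl

theorem inclXY_C (a : K) : inclXY (C a) = C a :=
  rename_C _ a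

theorem inclXY_X_zero : inclXY (X 0 : MvPolynomial (Fin 2) K) = X 0 :=
  rename_X _ _

theorem inclXY_X_one : inclXY (X 1 : MvPolynomial (Fin 2) K) = X 1 :=
  rename_X _ _

variable [CharZero K]

theorem exists_inclXY_eq_of_pderiv_two_eq_zero {p : MvPolynomial (Fin 3) K}
    (h : pderiv 2 p = 0) : ∃ q, inclXY q = p := by
  refine exists_rename_eq_of_vars_subset_range p _ (Fin.castSucc_injective 2) fun i hi ↦ ?_
  refine ⟨i.castPred fun h2 ↦ notMem_vars_of_pderiv_eq_zero h ?_, Fin.castSucc_castPred i _⟩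
  rw [h2] at hi
  exact hi

/-- If `∂₁h = e ∂₁u` with `∂₁e = 0` and `u`, `h` have vanishing Jacobian determinant, then `h` is
a scalar multiple of `u`. -/
theorem exists_eq_C_mul_of_pderiv_one_eq_mul {u h e : MvPolynomial (Fin 2) K}
    (hu : pderiv 1 u ≠ 0) (u_zero : eval 0 u = 0) (h_zero : eval 0 h = 0)
    (huh : pderiv 0 u * pderiv 1 h = pderiv 1 u * pderiv 0 h)
    (he : pderiv 1 h = e * pderiv 1 u) (he1 : pderiv 1 e = 0) : ∃ c, h = C c * u := by
  have he' : pderiv 0 h = e * pderiv 0 u := by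
    refine mul_left_cancel₀ hu ?_
    rw [← huh, he]
    ring
  -- As `dh = e du`, equality of the mixed derivatives gives `e_x u_y = e_y u_x = 0`.
  have he0 : pderiv 0 e = 0 := by
    refine (mul_eq_zero.1 ?_).resolve_right hu
    have h1 := congrArg (pderiv 0) he
    rw [pderiv_comm, he', Derivation.leibniz, Derivation.leibniz, he1, pderiv_comm 1 0] at h1
    simp only [smul_eq_mul, mul_zero, add_zero] at h1
    linear_combination -h1
  obtain ⟨c, rfl⟩ : ∃ c, e = C c := by
    refine exists_eq_C_of_pderiv_eq_zero fun i ↦ ?_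
    fin_cases i
    · exact he0
    · exact he1
  refine ⟨c, ?_⟩
  obtain ⟨a, ha⟩ : ∃ a, h - C c * u = C a := by
    refine exists_eq_C_of_pderiv_eq_zero fun i ↦ ?_
    fin_cases i
    · change pderiv 0 _ = 0
      simp [he']
    · change pderiv 1 _ = 0
      simp [he]
  have h0 := congrArg (eval 0) ha
  simp only [map_sub, map_mul, eval_C, u_zero, h_zero, mul_zero, sub_zero] at h0
  rwa [← h0, C_0, sub_eq_zero] at ha

/-- Applied to `p = v_z`. The hypotheses on `p` pass to `p_z`, so induction on the nilpotency order
of `∂_z` makes `p_z` a constant `c`. If `c ≠ 0`, then `h_y = -c⁻¹p_x u_y` with `p_x` free of `y` and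
`z`, and `h` would be a multiple of `u`. -/
theorem pderiv_two_eq_zero_of_iterate {u h : MvPolynomial (Fin 2) K}
    (hu : pderiv 1 u ≠ 0) (u_zero : eval 0 u = 0) (h_zero : eval 0 h = 0)
    (huh : pderiv 0 u * pderiv 1 h = pderiv 1 u * pderiv 0 h) (hne : ∀ c, h ≠ C c * u) (n : ℕ)
    (p : MvPolynomial (Fin 3) K) (hp : (pderiv 2)^[n] p = 0) (hp1 : pderiv 1 p = 0)
    (hp02 : pderiv 0 p * inclXY (pderiv 1 u) + inclXY (pderiv 1 h) * pderiv 2 p = 0) :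
    pderiv 2 p = 0 := by
  have hu' : inclXY (pderiv 1 u) ≠ 0 := (map_ne_zero_iff _ inclXY_injective).2 hu
  induction n generalizing p with
  | zero =>
    rw [Function.iterate_zero, id] at hp
    rw [hp, map_zero]
  | succ n ih =>
    have hr1 : pderiv 1 (pderiv 2 p) = 0 := by rw [pderiv_comm, hp1, map_zero]
    have hr02 : pderiv 0 (pderiv 2 p) * inclXY (pderiv 1 u) +
        inclXY (pderiv 1 h) * pderiv 2 (pderiv 2 p) = 0 := by
      have := congrArg (pderiv 2) hp02
      simp only [map_add, Derivation.leibniz, pderiv_two_inclXY, smul_eq_mul, mul_zero, zero_add,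
        add_zero, map_zero] at this
      rw [pderiv_comm]
      linear_combination this
    have hr2 := ih (pderiv 2 p) hp hr1 hr02
    have hr0 : pderiv 0 (pderiv 2 p) = 0 := by
      rw [hr2, mul_zero, add_zero] at hr02
      exact (mul_eq_zero.1 hr02).resolve_right hu'
    obtain ⟨c, hc⟩ : ∃ c, pderiv 2 p = C c := by
      refine exists_eq_C_of_pderiv_eq_zero fun i ↦ ?_
      fin_cases i
      · exact hr0
      · exact hr1
      · exact hr2
    by_contra hpz
    have hc0 : c ≠ 0 := fun h0 ↦ hpz (by rw [hc, h0, C_0])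
    obtain ⟨q, hq⟩ := exists_inclXY_eq_of_pderiv_two_eq_zero
      (show pderiv 2 (pderiv 0 p) = 0 by rw [pderiv_comm, hr0])
    have hq1 : pderiv 1 q = 0 := by
      refine inclXY_injective ?_
      rw [← pderiv_one_inclXY, hq, pderiv_comm, hp1, map_zero, map_zero]
    have heq : q * pderiv 1 u + pderiv 1 h * C c = 0 := by
      refine inclXY_injective ?_
      rw [map_add, map_mul, map_mul, hq, inclXY_C, ← hc, hp02, map_zero]
    have hcc : (C c : MvPolynomial (Fin 2) K) * C c⁻¹ = 1 := by
      rw [← C_mul, mul_inv_cancel₀ hc0, C_1]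
    obtain ⟨a, ha⟩ := exists_eq_C_mul_of_pderiv_one_eq_mul (e := -C c⁻¹ * q) hu u_zero h_zero huh
      (by linear_combination C c⁻¹ * heq - pderiv 1 h * hcc)
      (by simp [hq1])
    exact hne a ha

end Reduction

/-! ### The nilpotency equations and the assembly of the normal form. -/

section Reduction

variable {K : Type*} [Field K]

/-- The equations for a nilpotent Jacobian matrix: the trace, the sum of the principal minors of
order two and the determinant vanish. -/
theorem equations_of_isNilpotent_jacobianMatrix [CharZero K] {u h : MvPolynomial (Fin 2) K}
    {v : MvPolynomial (Fin 3) K} (hnil : IsNilpotent (jacobianMatrix (polyMap u v h))) :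
    inclXY (pderiv 0 u) + pderiv 1 v = 0 ∧
      inclXY (pderiv 0 u) * pderiv 1 v - inclXY (pderiv 1 u) * pderiv 0 v -
        inclXY (pderiv 1 h) * pderiv 2 v = 0 ∧
      pderiv 2 v * inclXY (pderiv 0 u * pderiv 1 h - pderiv 1 u * pderiv 0 h) = 0 := by
  obtain ⟨htr, htr2, hdet⟩ := Matrix.trace_mul_self_and_det_eq_zero_of_isNilpotent hnil
  simp only [jacobianMatrix, polyMap, Matrix.trace_fin_three, Matrix.det_fin_three, Matrix.mul_apply,
    Fin.sum_univ_three, Matrix.of_apply, Matrix.cons_val_zero, Matrix.cons_val_one,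
    Matrix.cons_val, pderiv_zero_inclXY, pderiv_one_inclXY, pderiv_two_inclXY] at htr htr2 hdet
  refine ⟨by linear_combination htr, ?_, ?_⟩
  · have h2 : (2 : MvPolynomial (Fin 3) K) ≠ 0 := two_ne_zero
    refine (mul_eq_zero.1 ?_).resolve_left h2
    linear_combination (inclXY (pderiv 0 u) + pderiv 1 v) * htr - htr2
  · rw [map_sub, map_mul, map_mul]
    linear_combination -hdet

theorem eq_zero_of_linearIndependent_polyMap {u h : MvPolynomial (Fin 2) K}
    {v : MvPolynomial (Fin 3) K} (hindep : LinearIndependent K (polyMap u v h)) {a b c : K}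
    (habc : C a * inclXY u + C b * v + C c * inclXY h = 0) : a = 0 ∧ b = 0 ∧ c = 0 := by
  rw [Fintype.linearIndependent_iff] at hindep
  have := hindep ![a, b, c] (by simpa [Fin.sum_univ_three, polyMap, smul_eq_C_mul] using habc)
  exact ⟨this 0, this 1, this 2⟩

/-- Over a field of characteristic zero, a map `(u(x, y), v(x, y, z), h(x, y))` with linearly
independent components and nilpotent Jacobian matrix has the normal form. -/
theorem hasNormalForm_of_isNilpotent_jacobianMatrix [CharZero K]
    (u : MvPolynomial (Fin 2) K) (v : MvPolynomial (Fin 3) K) (h : MvPolynomial (Fin 2) K)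
    (hzero : ∀ i, MvPolynomial.eval 0 (polyMap u v h i) = 0)
    (hindep : LinearIndependent K (polyMap u v h))
    (hnil : IsNilpotent (jacobianMatrix (polyMap u v h))) : HasNormalForm u v h := by
  obtain ⟨htr, hmin, hdet⟩ := equations_of_isNilpotent_jacobianMatrix hnil
  have u_zero : eval 0 u = 0 := by rw [← eval_zero_inclXY]; exact hzero 0
  have v_zero : eval 0 v = 0 := hzero 1
  have h_zero : eval 0 h = 0 := by rw [← eval_zero_inclXY]; exact hzero 2
  have hu_ne : u ≠ 0 := fun h0 ↦ one_ne_zero (α := K)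
    (eq_zero_of_linearIndependent_polyMap hindep (a := 1) (b := 0) (c := 0) (by simp [h0])).1
  have hne : ∀ c, h ≠ C c * u := fun c hc ↦ one_ne_zero (α := K)
    (eq_zero_of_linearIndependent_polyMap hindep (a := -c) (b := 0) (c := 1)
      (by rw [hc, map_mul, inclXY_C]; simp)).2.2
  have hv1 : pderiv 1 v = -inclXY (pderiv 0 u) := by linear_combination htr
  have hu1 : pderiv 1 u ≠ 0 := by
    intro h1
    -- With `u_y = 0` the minors give `u_x² = -h_y v_z` and the determinant gives `u_x h_y v_z = 0`.
    have h3 : inclXY (pderiv 0 u) ^ 3 = 0 := by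
      rw [h1] at hmin hdet
      simp only [map_zero, zero_mul, map_mul, sub_zero, hv1] at hmin hdet
      linear_combination -inclXY (pderiv 0 u) * hmin - hdet
    have h0 : pderiv 0 u = 0 :=
      inclXY_injective (by rw [pow_eq_zero_iff three_ne_zero] at h3; rw [h3, map_zero])
    refine hu_ne (eq_zero_of_pderiv_eq_zero (fun i ↦ ?_) u_zero)
    fin_cases i
    · exact h0
    · exact h1
  have hu1' : inclXY (pderiv 1 u) ≠ 0 := (map_ne_zero_iff _ inclXY_injective).2 hu1
  have huh_of (hv2 : pderiv 2 v ≠ 0) : pderiv 0 u * pderiv 1 h = pderiv 1 u * pderiv 0 h := by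
    have := (mul_eq_zero.1 hdet).resolve_left hv2
    exact sub_eq_zero.1 (inclXY_injective (by rw [this, map_zero]))
  have hv21 : pderiv 1 (pderiv 2 v) = 0 := by
    rw [pderiv_comm, hv1, map_neg, pderiv_two_inclXY, neg_zero]
  have hv02 : pderiv 0 (pderiv 2 v) * inclXY (pderiv 1 u) +
      inclXY (pderiv 1 h) * pderiv 2 (pderiv 2 v) = 0 := by
    have := congrArg (pderiv 2) hmin
    simp only [map_sub, Derivation.leibniz, pderiv_two_inclXY, smul_eq_mul, mul_zero,
      add_zero, map_zero, pderiv_comm 2 1 v, hv21, zero_sub] at this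
    rw [pderiv_comm]
    linear_combination -this
  have hv22 : pderiv 2 (pderiv 2 v) = 0 := by
    by_cases hv2 : pderiv 2 v = 0
    · rw [hv2, map_zero]
    · obtain ⟨n, hn⟩ := exists_iterate_pderiv_eq_zero 2 (pderiv 2 v)
      exact pderiv_two_eq_zero_of_iterate hu1 u_zero h_zero (huh_of hv2) hne n _ hn hv21 hv02
  obtain ⟨v₁, hv₁⟩ : ∃ v₁, pderiv 2 v = C v₁ := by
    refine exists_eq_C_of_pderiv_eq_zero fun i ↦ ?_
    fin_cases i
    · change pderiv 0 (pderiv 2 v) = 0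
      rw [hv22, mul_zero, add_zero] at hv02
      exact (mul_eq_zero.1 hv02).resolve_right hu1'
    · exact hv21
    · exact hv22
  obtain ⟨A, hA⟩ := exists_inclXY_eq_of_pderiv_two_eq_zero (p := v - C v₁ * X 2) (by simp [hv₁])
  have hv : v = C v₁ * X 2 + inclXY A := by rw [hA]; ring
  have A_zero : eval 0 A = 0 := by
    rw [← eval_zero_inclXY, hA, map_sub, map_mul, eval_X, v_zero, Pi.zero_apply, mul_zero, sub_zero]
  have hA0 : pderiv 0 v = inclXY (pderiv 0 A) := by
    rw [← pderiv_zero_inclXY, hv]; simp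
  have hA1' : pderiv 1 v = inclXY (pderiv 1 A) := by
    rw [← pderiv_one_inclXY, hv]; simp
  have hA1 : pderiv 1 A = -pderiv 0 u := inclXY_injective (by rw [← hA1', hv1, map_neg])
  have hκ : pderiv 0 u * pderiv 1 A - pderiv 1 u * pderiv 0 A = C v₁ * pderiv 1 h := by
    refine inclXY_injective ?_
    rw [map_sub, map_mul, map_mul, map_mul, ← hA0, ← hA1', inclXY_C, ← hv₁]
    linear_combination hmin
  -- If `v₁ = 0`, the relation between `u` and `h` is not available, but `h` drops out of the system
  -- and may be replaced by `0`. The solution then has `c = d = 0`, so `v = -mu`, against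
  -- independence.
  have hv₁0 : v₁ ≠ 0 := by
    rintro rfl
    obtain ⟨c, m, d, hs, hA', hh⟩ := planeSystem_solution (h := 0) (κ := 0) hu1 hA1 (by simp)
      (by rw [hκ]; simp) u_zero A_zero (map_zero _)
    have h2 : (C (c / 2) : MvPolynomial (Fin 2) K) * 2 = C c := by
      rw [← map_ofNat C 2, ← C_mul, div_mul_cancel₀ c two_ne_zero]
    have hcu : C c * u = 2 * C d := by
      refine mul_right_cancel₀ hu_ne ?_
      linear_combination -2 * hh - u ^ 2 * h2
    have hc : c = 0 := by
      have := congrArg (pderiv 1) hcu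
      rw [← map_ofNat C 2, ← C_mul, pderiv_C, pderiv_C_mul, mul_eq_zero] at this
      exact (C_eq_zero).1 (this.resolve_right hu1)
    have hd : d = 0 := by
      rw [hc, C_0, zero_mul, eq_comm, mul_eq_zero] at hcu
      exact C_eq_zero.1 (hcu.resolve_left two_ne_zero)
    refine one_ne_zero (α := K)
      (eq_zero_of_linearIndependent_polyMap hindep (a := m) (b := 1) (c := 0) ?_).2.1
    rw [hv, hA', hc, hd]
    simp only [C_1, zero_mul, map_sub, map_add, map_mul, map_zero, inclXY_C]
    ring
  obtain ⟨c, m, d, hs, hA', hh⟩ := planeSystem_solution hu1 hA1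
    (huh_of (by rw [hv₁]; exact (C_eq_zero (σ := Fin 3)).not.2 hv₁0)) hκ u_zero A_zero h_zero
  have hvv : (C v₁ : MvPolynomial (Fin 2) K) * C v₁⁻¹ = 1 := by
    rw [← C_mul, mul_inv_cancel₀ hv₁0, C_1]
  have hc0 : c ≠ 0 := by
    rintro rfl
    refine hne (-(d * v₁⁻¹)) ?_
    rw [zero_div, C_0] at hh
    rw [C_neg, C_mul]
    linear_combination C v₁⁻¹ * hh - h * hvv
  obtain ⟨b, hb⟩ : ∃ b : Polynomial K, b = Polynomial.C (c / 2) * Polynomial.X ^ 2 +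
      Polynomial.C m * Polynomial.X + Polynomial.C 0 := ⟨_, rfl⟩
  have hb' : Polynomial.derivative b = Polynomial.C c * Polynomial.X + Polynomial.C m := by
    have h2 : Polynomial.C (c / 2) * 2 = Polynomial.C c := by
      rw [← map_ofNat Polynomial.C 2, ← Polynomial.C_mul, div_mul_cancel₀ c two_ne_zero]
    rw [hb]
    simp only [Polynomial.derivative_add, Polynomial.derivative_mul, Polynomial.derivative_C,
      Polynomial.derivative_X_pow, Polynomial.derivative_X, zero_mul, zero_add, mul_one, add_zero]
    rw [Nat.cast_two, map_ofNat]
    linear_combination Polynomial.X * h2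
  have hb'x : Polynomial.aeval (X 0 : MvPolynomial (Fin 2) K) (Polynomial.derivative b) =
      C c * X 0 + C m := by
    rw [hb']; simp [algebraMap_eq]
  obtain ⟨g, hg⟩ := exists_eq_aeval_of_pderiv_zero_eq (u := u) (b := b) (by rw [hb'x, hs])
  have hb3 : inclXY (Polynomial.aeval (X 0 : MvPolynomial (Fin 2) K) b) = Polynomial.aeval (X 0) b := by
    rw [← Polynomial.aeval_algHom_apply, inclXY_X_zero]
  have hu3 : inclXY u = Polynomial.aeval (X 1 + Polynomial.aeval (X 0) b) g := by
    rw [hg, ← Polynomial.aeval_algHom_apply, map_add, hb3, inclXY_X_one]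
  have hb'x3 : Polynomial.aeval (X 0 : MvPolynomial (Fin 3) K) (Polynomial.derivative b) =
      C c * X 0 + C m := by
    rw [hb']; simp [algebraMap_eq]
  have hg0 : g.eval 0 = 0 := by
    have hb0 : aeval (0 : Fin 2 → K) (X 1 + Polynomial.aeval (X 0) b : MvPolynomial (Fin 2) K) = 0 := by
      rw [hb]
      simp only [map_add, map_mul, map_pow, Polynomial.aeval_C, Polynomial.aeval_X, algebraMap_eq,
        aeval_C, aeval_X, Pi.zero_apply]
      simp
    rw [hg, ← coe_aeval_eq_eval, RingHom.coe_coe, ← Polynomial.aeval_algHom_apply,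
      hb0] at u_zero
    rwa [Polynomial.coe_aeval_eq_eval] at u_zero
  -- The choice `a = 1`, `m₂ = 0` suffices, as `g` absorbs a rescaling or a shift of its argument.
  -- The values of `c₀` and `l₂` come from dividing `v₁h = (c/2)u² - du` by `v₁`.
  refine ⟨v₁, c / 2 * v₁⁻¹, 1, m, -(d * v₁⁻¹), 0, g, b, hv₁0,
    mul_ne_zero (div_ne_zero hc0 two_ne_zero) (inv_ne_zero hv₁0), one_ne_zero, hg0, ?_, ?_, ?_,
    ?_, ?_⟩
  · by_contra hdeg
    rw [not_le, Nat.lt_one_iff] at hdeg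
    rw [Polynomial.eq_C_of_natDegree_eq_zero hdeg, Polynomial.eval_C] at hg0
    rw [Polynomial.eq_C_of_natDegree_eq_zero hdeg, hg0, map_zero, map_zero] at hg
    exact hu_ne hg
  · rw [hb, mul_one, mul_comm (c / 2), mul_inv_cancel_left₀ hv₁0]
  · rw [C_1, one_mul, ← hg]
  · have hvd : v₁ * -(d * v₁⁻¹) = -d := by
      field_simp
    rw [inv_one, C_1, one_mul, one_mul, ← hu3, hb'x3, hvd, hv, hA', C_neg]
    simp only [map_sub, map_add, map_mul, inclXY_C, inclXY_X_zero]
    ring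
  · rw [C_neg, C_mul, C_mul]
    linear_combination C v₁⁻¹ * hh - h * hvv

end Reduction

theorem corollary2p6 {K : Type*} [Field K] [IsAlgClosed K] [CharZero K]
    (u : MvPolynomial (Fin 2) K) (v : MvPolynomial (Fin 3) K) (h : MvPolynomial (Fin 2) K)
    (hzero : ∀ i, MvPolynomial.eval 0 (polyMap u v h i) = 0)
    (hindep : LinearIndependent K (polyMap u v h))
    (hnil : IsNilpotent (jacobianMatrix (polyMap u v h)))
    (hirr : IsIrreducibleVariety (hypersurface (MvPolynomial.pderiv 1 u)) ∨
      IsIrreducibleVariety (hypersurface (MvPolynomial.pderiv 1 h))) :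
    HasNormalForm u v h :=
  hasNormalForm_of_isNilpotent_jacobianMatrix u v h hzero hindep hnil
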